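/- Let $d,p\in\mathbb N$ and let $Z=(Z_1,\dots,Z_p)^{\mathrm T}$ be a random field on $\mathbb R^d$ whose coordinates are independent stationary Gaussian processes with mean zero, unit variance and covariance functions $K_1,\dots,K_p$, that is, $\operatorname{cov}\{Z_k(x),Z_k(y)\}=K_k(x-y)$ and $K_k(0)=1$. Let $X=\Omega Z$ with $\Omega$ a fixed invertible $p\times p$ matrix. For each $n$ let $X$ be observed at points $s_1,\dots,s_n\in\mathbb R^d$ (which may depend on $n$), and suppose that a fixed $\Delta>0$ satisfies $\|s_i-s_j\|\ge\Delta$ for all $n$ and all $i\ne j$. Suppose that fixed $A>0$ and $\alpha>0$ satisfy $|K_k(x)|\le A/(1+\|x\|^{d+\alpha})$ for all $x\in\mathbb R^d$ and all $k=1,\dots,p$, and let $f:\mathbb R^d\to\mathbb R$ satisfy $|f(x)|\le A/(1+\|x\|^{d+\alpha})$ for all $x\in\mathbb R^d$. Let $f_0(x)=I(x=0)$. For $g\in\{f,f_0\}$ let $$\widehat M(g)=n^{-1}\sum_{i,j=1}^n g(s_i-s_j)X(s_i)X(s_j)^{\mathrm T},\qquad M(g)=n^{-1}\sum_{i,j=1}^n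 g(s_i-s_j)\,\mathrm E\{X(s_i)X(s_j)^{\mathrm T}\},$$ let $W(g)\in\mathbb R^{p^2}$ be the row vectorisation of $n^{1/2}\{\widehat M(g)-M(g)\}$, so that $W(g)_{(a-1)p+b}=n^{1/2}\{\widehat M(g)_{a,b}-M(g)_{a,b}\}$ for $a,b\in\{1,\dots,p\}$, and let $Q_n$ be the distribution of $\{W(f)^{\mathrm T},W(f_0)^{\mathrm T}\}^{\mathrm T}$ on $\mathbb R^{2p^2}$. Let $R$ be the $np\times np$ covariance matrix of the vector $y$ with $y_{(i-1)p+j}=X_j(s_i)$. For $b,l\in\{1,\dots,p\}$ let $T(g)_{b,l}$ be the $np\times np$ matrix with $p\times p$ blocks $$\tfrac12\{g(s_i-s_j)\,e_be_l^{\mathrm T}+g(s_j-s_i)\,e_le_b^{\mathrm T}\},\qquad i,j=1,\dots,n,$$ where $e_1,\dots,e_p$ is the standard basis of $\mathbb R^p$; if $g$ is even, these blocks are $g(s_i-s_j)\tfrac12(e_be_l^{\mathrm T}+e_le_b^{\mathrm T})$. Let $\Sigma(g,h)$ be the $p^2\times p^2$ matrix with $$\Sigma(g,h)_{(s-1)p+t,\,(u-1)p+v}=2n^{-1}\operatorname{tr}\{R\,T(g)_{s,t}\,R\,T(h)_{u,v}\},\qquad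 s,t,u,v\in\{1,\dots,p\},$$ and let $$V(f,f_0)=\begin{pmatrix}\Sigma(f,f)&\Sigma(f,f_0)\\ \Sigma(f_0,f)&\Sigma(f_0,f_0)\end{pmatrix}.$$ Then $V(f,f_0)$ is symmetric non-negative definite for every $n$; for every metric $d_w$ generating the topology of weak convergence on the set of Borel probability measures on $\mathbb R^{2p^2}$, $$d_w[Q_n,\mathcal N\{0,V(f,f_0)\}]\to0\qquad\text{as }n\to\infty;$$ and the largest eigenvalue of $V(f,f_0)$ is bounded as $n\to\infty$. -/

import Mathlib

open MeasureTheory ProbabilityTheory Filter Topology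

noncomputable section

namespace SpatialBSS

variable {𝓤 : Type*} [MeasurableSpace 𝓤] {d p n : ℕ}

/-- Assumptions on the latent field `Z = (Z_1, …, Z_p)` on `ℝ^d`: the coordinates are independent
Gaussian processes with mean zero, unit variance and covariance `K_k (x - y)` (so each of them is
stationary). -/
structure IsLatentField (P : Measure 𝓤)
    (Z : Fin p → EuclideanSpace ℝ (Fin d) → 𝓤 → ℝ)
    (K : Fin p → EuclideanSpace ℝ (Fin d) → ℝ) : Prop where
  measurable : ∀ k x, Measurable (Z k x)
  gaussian : ∀ k, IsGaussianProcess (Z k) P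
  /-- Independence of the whole processes: cross-covariances between coordinates vanish. -/
  indep : iIndepFun (fun k ω x => Z k x ω) P
  mean_zero : ∀ k x, ∫ ω, Z k x ω ∂P = 0
  cov_eq : ∀ k x y, covariance (Z k x) (Z k y) P = K k (x - y)
  unit_variance : ∀ k, K k 0 = 1

/-- The polynomial decay bound `|g x| ≤ A / (1 + ‖x‖^(d+α))`. -/
def HasDecay (A α : ℝ) (g : EuclideanSpace ℝ (Fin d) → ℝ) : Prop :=
  ∀ x, |g x| ≤ A / (1 + ‖x‖ ^ ((d : ℝ) + α))

/-- The observed field `X(s) = Ω Z(s)`. -/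
def obs (Ω : Matrix (Fin p) (Fin p) ℝ) (Z : Fin p → EuclideanSpace ℝ (Fin d) → 𝓤 → ℝ)
    (a : Fin p) (x : EuclideanSpace ℝ (Fin d)) (ω : 𝓤) : ℝ :=
  ∑ k, Ω a k * Z k x ω

open Classical in
/-- The kernel `f₀(s) = I(s = 0)`. -/
def f₀ (x : EuclideanSpace ℝ (Fin d)) : ℝ := if x = 0 then 1 else 0

/-- The local covariance matrix `n⁻¹ ∑_{i,j} f(s_i - s_j) X(s_i) X(s_j)ᵀ` of a field `X`. -/
def Mhat (X : Fin p → EuclideanSpace ℝ (Fin d) → 𝓤 → ℝ) (s : Fin n → EuclideanSpace ℝ (Fin d))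
    (f : EuclideanSpace ℝ (Fin d) → ℝ) (ω : 𝓤) : Matrix (Fin p) (Fin p) ℝ :=
  Matrix.of fun a b => (n : ℝ)⁻¹ * ∑ i, ∑ j, f (s i - s j) * (X a (s i) ω * X b (s j) ω)

/-- The population version `n⁻¹ ∑_{i,j} f(s_i - s_j) E{X(s_i) X(s_j)ᵀ}`. -/
def Mpop (P : Measure 𝓤) (X : Fin p → EuclideanSpace ℝ (Fin d) → 𝓤 → ℝ)
    (s : Fin n → EuclideanSpace ℝ (Fin d))
    (f : EuclideanSpace ℝ (Fin d) → ℝ) : Matrix (Fin p) (Fin p) ℝ :=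
  Matrix.of fun a b =>
    (n : ℝ)⁻¹ * ∑ i, ∑ j, f (s i - s j) * ∫ ω, X a (s i) ω * X b (s j) ω ∂P

/-- Row vectorisation `W(f)` of `n^{1/2} (Mhat f - M f)`; the pair `(a, b)` stands for the
coordinate `(a - 1) p + b`. -/
def W (P : Measure 𝓤) (X : Fin p → EuclideanSpace ℝ (Fin d) → 𝓤 → ℝ)
    (s : Fin n → EuclideanSpace ℝ (Fin d)) (f : EuclideanSpace ℝ (Fin d) → ℝ) (ω : 𝓤) :
    Fin p × Fin p → ℝ :=
  fun ab => √(n : ℝ) * (Mhat X s f ω ab.1 ab.2 - Mpop P X s f ab.1 ab.2)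

/-- Indices of the `2 p²` coordinates of `(W(f)ᵀ, W(g)ᵀ)ᵀ`: first those of `W(f)`, then those of
`W(g)`. -/
abbrev Idx (p : ℕ) : Type := (Fin p × Fin p) ⊕ (Fin p × Fin p)

/-- The random vector `(W(f)ᵀ, W(g)ᵀ)ᵀ`. -/
def jointW (P : Measure 𝓤) (X : Fin p → EuclideanSpace ℝ (Fin d) → 𝓤 → ℝ)
    (s : Fin n → EuclideanSpace ℝ (Fin d)) (f g : EuclideanSpace ℝ (Fin d) → ℝ) (ω : 𝓤) :
    EuclideanSpace ℝ (Idx p) :=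
  WithLp.toLp 2 (Sum.elim (W P X s f ω) (W P X s g ω))

lemma measurable_obs {P : Measure 𝓤} {Z : Fin p → EuclideanSpace ℝ (Fin d) → 𝓤 → ℝ}
    {K : Fin p → EuclideanSpace ℝ (Fin d) → ℝ} (hZ : IsLatentField P Z K)
    (Ω : Matrix (Fin p) (Fin p) ℝ) (a : Fin p) (x : EuclideanSpace ℝ (Fin d)) :
    Measurable (obs Ω Z a x) :=
  Finset.measurable_sum _ fun k _ => (hZ.measurable k x).const_mul _

lemma measurable_W (P : Measure 𝓤) {X : Fin p → EuclideanSpace ℝ (Fin d) → 𝓤 → ℝ}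
    (hX : ∀ a x, Measurable (X a x)) (s : Fin n → EuclideanSpace ℝ (Fin d))
    (f : EuclideanSpace ℝ (Fin d) → ℝ) : Measurable (W P X s f) := by
  refine measurable_pi_lambda _ fun ab => ?_
  refine ((Measurable.const_mul ?_ _).sub_const _).const_mul _
  exact Finset.measurable_sum _ fun i _ => Finset.measurable_sum _ fun j _ =>
    ((hX _ _).mul (hX _ _)).const_mul _

lemma measurable_jointW (P : Measure 𝓤) {X : Fin p → EuclideanSpace ℝ (Fin d) → 𝓤 → ℝ}
    (hX : ∀ a x, Measurable (X a x)) (s : Fin n → EuclideanSpace ℝ (Fin d))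
    (f g : EuclideanSpace ℝ (Fin d) → ℝ) : Measurable (jointW P X s f g) := by
  refine (WithLp.measurable_toLp 2 (Idx p → ℝ)).comp (measurable_pi_lambda _ fun i => ?_)
  cases i with
  | inl ab => exact (measurable_pi_apply ab).comp (measurable_W P hX s f)
  | inr ab => exact (measurable_pi_apply ab).comp (measurable_W P hX s g)

/-- The distribution of `(W(f)ᵀ, W(g)ᵀ)ᵀ` for the field `X = Ω Z`. -/
def Q (P : Measure 𝓤) [IsProbabilityMeasure P] {Z : Fin p → EuclideanSpace ℝ (Fin d) → 𝓤 → ℝ}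
    {K : Fin p → EuclideanSpace ℝ (Fin d) → ℝ} (hZ : IsLatentField P Z K)
    (Ω : Matrix (Fin p) (Fin p) ℝ) (s : Fin n → EuclideanSpace ℝ (Fin d))
    (f g : EuclideanSpace ℝ (Fin d) → ℝ) : ProbabilityMeasure (EuclideanSpace ℝ (Idx p)) :=
  ⟨P.map (jointW P (obs Ω Z) s f g),
    Measure.isProbabilityMeasure_map
      (measurable_jointW P (measurable_obs hZ Ω) s f g).aemeasurable⟩

/-- The covariance matrix of the vector `y` of all observations `X_a(s_i)`, whose `(i, a)` entry
stands for the coordinate `(i - 1) p + a`. -/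
def R (P : Measure 𝓤) (X : Fin p → EuclideanSpace ℝ (Fin d) → 𝓤 → ℝ)
    (s : Fin n → EuclideanSpace ℝ (Fin d)) : Matrix (Fin n × Fin p) (Fin n × Fin p) ℝ :=
  Matrix.of fun ia jb => covariance (X ia.2 (s ia.1)) (X jb.2 (s jb.1)) P

/-- The symmetric `np × np` matrix of the quadratic form `n Mhat(f)_{b,l}` in `y`: its `p × p`
block `(i, j)` is `(1/2) {f(s_i - s_j) e_b e_lᵀ + f(s_j - s_i) e_l e_bᵀ}`. -/
def T (s : Fin n → EuclideanSpace ℝ (Fin d)) (f : EuclideanSpace ℝ (Fin d) → ℝ) (b l : Fin p) :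
    Matrix (Fin n × Fin p) (Fin n × Fin p) ℝ :=
  Matrix.of fun ia jc =>
    ((1 / 2 : ℝ) • (f (s ia.1 - s jc.1) • Matrix.single b l (1 : ℝ) +
      f (s jc.1 - s ia.1) • Matrix.single l b (1 : ℝ))) ia.2 jc.2

/-- For an even kernel the block `(i, j)` of `T` is
`f(s_i - s_j) (1/2) (e_b e_lᵀ + e_l e_bᵀ)`. -/
lemma T_of_even (s : Fin n → EuclideanSpace ℝ (Fin d)) (f : EuclideanSpace ℝ (Fin d) → ℝ)
    (hf : ∀ x, f (-x) = f x) (b l : Fin p) :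
    T s f b l = Matrix.of fun ia jc =>
      (f (s ia.1 - s jc.1) • (1 / 2 : ℝ) •
        (Matrix.single b l (1 : ℝ) + Matrix.single l b (1 : ℝ))) ia.2 jc.2 := by
  ext ia jc
  have h : f (s jc.1 - s ia.1) = f (s ia.1 - s jc.1) := by rw [← hf, neg_sub]
  simp only [T, Matrix.of_apply, h, Matrix.smul_apply, Matrix.add_apply, smul_eq_mul]
  ring

/-- `Σ(f, g)_{(a,b),(u,v)} = 2 n⁻¹ tr{R T(f)_{a,b} R T(g)_{u,v}}`. -/
def Sig (P : Measure 𝓤) (X : Fin p → EuclideanSpace ℝ (Fin d) → 𝓤 → ℝ)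
    (s : Fin n → EuclideanSpace ℝ (Fin d)) (f g : EuclideanSpace ℝ (Fin d) → ℝ) :
    Matrix (Fin p × Fin p) (Fin p × Fin p) ℝ :=
  Matrix.of fun ab uv =>
    2 * (n : ℝ)⁻¹ * (R P X s * T s f ab.1 ab.2 * R P X s * T s g uv.1 uv.2).trace

/-- The block matrix `V(f, g)` with rows `(Σ(f,f), Σ(f,g))` and `(Σ(g,f), Σ(g,g))`. -/
def V (P : Measure 𝓤) (X : Fin p → EuclideanSpace ℝ (Fin d) → 𝓤 → ℝ)
    (s : Fin n → EuclideanSpace ℝ (Fin d)) (f g : EuclideanSpace ℝ (Fin d) → ℝ) :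
    Matrix (Idx p) (Idx p) ℝ :=
  Matrix.fromBlocks (Sig P X s f f) (Sig P X s f g) (Sig P X s g f) (Sig P X s g g)

/-- The centred normal distribution with covariance matrix `S` (positive semidefinite). -/
def normal {ι : Type*} [Fintype ι] [DecidableEq ι] (S : Matrix ι ι ℝ) :
    ProbabilityMeasure (EuclideanSpace ℝ ι) :=
  ⟨multivariateGaussian 0 S, inferInstance⟩

/-- The topology of weak convergence on the Borel probability measures of `ℝ^ι`. -/
abbrev weakTopology (ι : Type*) [Fintype ι] :
    TopologicalSpace (ProbabilityMeasure (EuclideanSpace ℝ ι)) :=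
  inferInstance

/-- The metric `m` generates the topology of weak convergence. -/
def GeneratesWeakTopology {ι : Type*} [Fintype ι]
    (m : MetricSpace (ProbabilityMeasure (EuclideanSpace ℝ ι))) : Prop :=
  m.toPseudoMetricSpace.toUniformSpace.toTopologicalSpace = weakTopology ι

end SpatialBSS

end

/-!
The argument is a central limit theorem for quadratic forms in a Gaussian vector, carried out with
characteristic functions.

The vector `y` of all observations is centred Gaussian with covariance matrix `R`
(`map_obsVec`), and every linear combination `⟨t, (W(f), W(f₀))⟩` equals
`n^(-1/2) (yᵀ B y - E yᵀ B y)` for a symmetric matrix `B` depending linearly on `t`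
(`inner_jointW`). Writing `y = R^{1/2} g` with `g` standard normal and diagonalising
`R^{1/2} B R^{1/2}` turns this into `n^(-1/2) ∑ λ_i (ξ_i² - 1)` with independent standard normal
`ξ_i` (`exists_map_pi_eq_multivariateGaussian`), so that its characteristic function is a product
(`charFun_Q`), while `tᵀ V t = (2 / n) ∑ λ_i²` (`quadForm_V`). In particular `V` is positive
semidefinite.

The eigenvalues `λ_i` are bounded independently of `n`. Indeed they are at most the product of the
largest absolute row sums of `R` and of `B` (`abs_eigenvalues_conjSqrt_le`), and these row sums are
bounded because the weights `1 / (1 + ‖s_i - s_j‖^(d+α))` are uniformly summable over separated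
points (`exists_sum_weight_le`). Hence `tᵀ V t` is bounded by a multiple of `‖t‖²`, which bounds the
largest eigenvalue and the entries of `V`. The second-order expansion at the origin of the
characteristic function of `ξ² - 1` then shows that the characteristic functions of `Q_n` and of
`N(0, V)` become close pointwise (`tendsto_charFun_sub`).

Since `V` need not converge, a subsequence argument concludes: every subsequence has a further one
along which `V` converges, and along it `Q_n` and `N(0, V)` have the same weak limit by Lévy's
continuity theorem (`tendsto_dist_normal`).
-/

noncomputable section

namespace SpatialBSS

/-! ### Separated point configurations -/

lemma decay_weight_le {r : ℝ} (hr : 0 ≤ r) {t : ℝ} (ht : 0 ≤ t) :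
    1 / (1 + t ^ r) ≤ 2 ^ r * (1 + t) ^ (-r) := by
  have h1 : (1 + t) ^ r ≤ 2 ^ r * (1 + t ^ r) := by
    rcases le_total t 1 with h | h
    · calc (1 + t) ^ r ≤ 2 ^ r := Real.rpow_le_rpow (by linarith) (by linarith) hr
        _ ≤ 2 ^ r * (1 + t ^ r) := by
          have := Real.rpow_nonneg ht r
          have h2 : (0 : ℝ) < 2 ^ r := by positivity
          nlinarith
    · calc (1 + t) ^ r ≤ (2 * t) ^ r := Real.rpow_le_rpow (by linarith) (by linarith) hr
        _ = 2 ^ r * t ^ r := Real.mul_rpow (by norm_num) ht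
        _ ≤ 2 ^ r * (1 + t ^ r) := by gcongr; linarith
  have h3 : 0 < (1 + t) ^ r := by positivity
  have h4 : 0 < 1 + t ^ r := by positivity
  rw [Real.rpow_neg (by linarith), ← div_eq_mul_inv, div_le_div_iff₀ h4 h3]
  linarith

/-- Points of `ℝ^d` at mutual distance at least `Δ` have uniformly bounded sums of the weights
`1 / (1 + ‖x - s_j‖^r)` with `r > d`: the balls of radius `Δ / 2` around them are disjoint, and on
each of them the weight is comparable to the integrable function `(1 + ‖x - y‖)^(-r)` of `y`. -/
lemma exists_sum_weight_le (d : ℕ) {r Δ : ℝ} (hr : (d : ℝ) < r) (hΔ : 0 < Δ) :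
    ∃ C : ℝ, 0 ≤ C ∧ ∀ {n : ℕ} (s : Fin n → EuclideanSpace ℝ (Fin d)),
      (∀ i j, i ≠ j → Δ ≤ ‖s i - s j‖) → ∀ x,
        ∑ j, 1 / (1 + ‖x - s j‖ ^ r) ≤ C := by
  have hr0 : 0 ≤ r := (Nat.cast_nonneg d).trans hr.le
  have hint : Integrable (fun y : EuclideanSpace ℝ (Fin d) => (1 + ‖y‖) ^ (-r)) :=
    integrable_one_add_norm (by simpa using hr)
  set I := ∫ y : EuclideanSpace ℝ (Fin d), (1 + ‖y‖) ^ (-r) with hI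
  set v := (volume (Metric.ball (0 : EuclideanSpace ℝ (Fin d)) (Δ / 2))).toReal with hv
  have hvpos : 0 < v :=
    ENNReal.toReal_pos (Metric.measure_ball_pos _ _ (by positivity)).ne' measure_ball_lt_top.ne
  have hI0 : 0 ≤ I := integral_nonneg fun y => by positivity
  refine ⟨2 ^ r * ((1 + Δ / 2) ^ r * (I / v)), by positivity, fun {n} s hs x => ?_⟩
  have hball : ∀ j, (1 + ‖x - s j‖) ^ (-r) * v ≤
      (1 + Δ / 2) ^ r * ∫ y in Metric.ball (s j) (Δ / 2), (1 + ‖x - y‖) ^ (-r) := by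
    intro j
    have hle : ∀ y ∈ Metric.ball (s j) (Δ / 2),
        (1 + ‖x - s j‖) ^ (-r) ≤ (1 + Δ / 2) ^ r * (1 + ‖x - y‖) ^ (-r) := by
      intro y hy
      have hy' : ‖y - s j‖ < Δ / 2 := by simpa [dist_eq_norm] using hy
      have h1 : ‖x - y‖ ≤ ‖x - s j‖ + Δ / 2 := by
        have := norm_sub_le (x - s j) (y - s j)
        rw [sub_sub_sub_cancel_right] at this
        linarith
      have h2 : 1 + ‖x - y‖ ≤ (1 + Δ / 2) * (1 + ‖x - s j‖) := by
        nlinarith [norm_nonneg (x - s j)]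
      have h3 : (1 + ‖x - y‖) ^ r ≤ (1 + Δ / 2) ^ r * (1 + ‖x - s j‖) ^ r := by
        rw [← Real.mul_rpow (by positivity) (by positivity)]
        exact Real.rpow_le_rpow (by positivity) h2 hr0
      rw [Real.rpow_neg (by positivity), Real.rpow_neg (by positivity), ← div_eq_mul_inv,
        inv_eq_one_div, div_le_div_iff₀ (by positivity) (by positivity)]
      linarith
    have hint' : IntegrableOn (fun y => (1 + ‖x - y‖) ^ (-r)) (Metric.ball (s j) (Δ / 2)) :=
      (hint.comp_sub_left x).integrableOn
    have hvj : v = (volume (Metric.ball (s j) (Δ / 2))).toReal := by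
      rw [hv, Measure.addHaar_ball_center volume (s j)]
    calc (1 + ‖x - s j‖) ^ (-r) * v
        = ∫ y in Metric.ball (s j) (Δ / 2), (1 + ‖x - s j‖) ^ (-r) := by
          rw [setIntegral_const, hvj, smul_eq_mul, mul_comm, measureReal_def]
      _ ≤ ∫ y in Metric.ball (s j) (Δ / 2), (1 + Δ / 2) ^ r * (1 + ‖x - y‖) ^ (-r) :=
          setIntegral_mono_on (integrableOn_const measure_ball_lt_top.ne)
            (hint'.const_mul _) measurableSet_ball hle
      _ = _ := integral_const_mul _ _
  have hdisj : Pairwise (Function.onFun Disjoint fun j => Metric.ball (s j) (Δ / 2)) := by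
    intro i j hij
    apply Metric.ball_disjoint_ball
    rw [dist_eq_norm]
    linarith [hs i j hij]
  have htot : ∑ j, ∫ y in Metric.ball (s j) (Δ / 2), (1 + ‖x - y‖) ^ (-r) ≤ I := by
    rw [← integral_iUnion_fintype (fun _ => measurableSet_ball) hdisj
      (fun _ => (hint.comp_sub_left x).integrableOn), hI,
      ← integral_sub_left_eq_self (fun y : EuclideanSpace ℝ (Fin d) => (1 + ‖y‖) ^ (-r)) volume x]
    exact setIntegral_le_integral (hint.comp_sub_left x) (ae_of_all _ fun y => by positivity)
  have hsum : (∑ j, (1 + ‖x - s j‖) ^ (-r)) * v ≤ (1 + Δ / 2) ^ r * I := by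
    rw [Finset.sum_mul]
    refine (Finset.sum_le_sum fun j _ => hball j).trans ?_
    rw [← Finset.mul_sum]
    gcongr
  calc ∑ j, 1 / (1 + ‖x - s j‖ ^ r)
      ≤ ∑ j, 2 ^ r * (1 + ‖x - s j‖) ^ (-r) :=
        Finset.sum_le_sum fun j _ => decay_weight_le hr0 (norm_nonneg _)
    _ = 2 ^ r * ∑ j, (1 + ‖x - s j‖) ^ (-r) := by rw [Finset.mul_sum]
    _ ≤ 2 ^ r * ((1 + Δ / 2) ^ r * (I / v)) := by
        gcongr
        rw [← mul_div_assoc, le_div_iff₀ hvpos]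
        exact hsum

/-! ### Symmetric matrices and quadratic forms -/

section Matrix

open Matrix
open scoped MatrixOrder RealInnerProductSpace

variable {ι κ : Type*} [Fintype ι] [Fintype κ]

/-- The Schur test for the quadratic form of a symmetric matrix. -/
lemma abs_quadForm_le {B : Matrix ι ι ℝ} (hB : B.IsSymm) {C : ℝ}
    (hC : ∀ i, ∑ j, |B i j| ≤ C) (x : ι → ℝ) : |x ⬝ᵥ B *ᵥ x| ≤ C * (x ⬝ᵥ x) := by
  have h1 : |x ⬝ᵥ B *ᵥ x| ≤ ∑ i, ∑ j, |B i j| * ((x i ^ 2 + x j ^ 2) / 2) := by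
    simp only [dotProduct, mulVec, Finset.mul_sum]
    refine (Finset.abs_sum_le_sum_abs _ _).trans (Finset.sum_le_sum fun i _ => ?_)
    refine (Finset.abs_sum_le_sum_abs _ _).trans (Finset.sum_le_sum fun j _ => ?_)
    rw [abs_mul, abs_mul, mul_left_comm]
    refine mul_le_mul_of_nonneg_left ?_ (abs_nonneg _)
    nlinarith [sq_nonneg (|x i| - |x j|), sq_abs (x i), sq_abs (x j)]
  have h2 : ∑ i, ∑ j, |B i j| * ((x i ^ 2 + x j ^ 2) / 2) = ∑ i, (∑ j, |B i j|) * x i ^ 2 := by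
    have h3 : ∑ i, ∑ j, |B i j| * x j ^ 2 = ∑ i, ∑ j, |B i j| * x i ^ 2 := by
      rw [Finset.sum_comm]
      refine Finset.sum_congr rfl fun i _ => Finset.sum_congr rfl fun j _ => ?_
      rw [hB.apply]
    have h4 : ∀ i j, |B i j| * ((x i ^ 2 + x j ^ 2) / 2) =
        1 / 2 * (|B i j| * x i ^ 2) + 1 / 2 * (|B i j| * x j ^ 2) := fun i j => by ring
    simp only [h4, Finset.sum_add_distrib, ← Finset.mul_sum, h3, Finset.sum_mul]
    ring
  rw [h2] at h1
  refine h1.trans ?_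
  simp only [dotProduct, Finset.mul_sum]
  refine Finset.sum_le_sum fun i _ => ?_
  rw [← pow_two]
  exact mul_le_mul_of_nonneg_right (hC i) (sq_nonneg _)

lemma isSymm_sum_smul {ι : Type*} {T : κ → Matrix ι ι ℝ} (hT : ∀ k, (T k).IsSymm) (x : κ → ℝ) :
    (∑ k, x k • T k).IsSymm := by
  rw [IsSymm, transpose_sum]
  exact Finset.sum_congr rfl fun k _ => by rw [transpose_smul, (hT k).eq]

lemma quadForm_trace (R : Matrix ι ι ℝ) (T : κ → Matrix ι ι ℝ) (c : ℝ) (x : κ → ℝ) :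
    x ⬝ᵥ (Matrix.of fun k l => c * (R * T k * R * T l).trace) *ᵥ x =
      c * (R * (∑ k, x k • T k) * R * (∑ k, x k • T k)).trace := by
  simp only [dotProduct, mulVec, of_apply, Matrix.sum_mul, trace_sum,
    Finset.mul_sum, mul_smul_comm, smul_mul_assoc, trace_smul, smul_eq_mul]
  rw [Finset.sum_comm]
  refine Finset.sum_congr rfl fun k _ => Finset.sum_congr rfl fun l _ => ?_
  ring

lemma sum_abs_sum_smul_le {T : κ → Matrix ι ι ℝ} {C : ℝ} (hT : ∀ k i, ∑ j, |T k i j| ≤ C)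
    (x : κ → ℝ) (i : ι) : ∑ j, |(∑ k, x k • T k) i j| ≤ (∑ k, |x k|) * C := by
  calc ∑ j, |(∑ k, x k • T k) i j| ≤ ∑ j, ∑ k, |x k| * |T k i j| := by
        refine Finset.sum_le_sum fun j _ => ?_
        rw [Matrix.sum_apply]
        refine (Finset.abs_sum_le_sum_abs _ _).trans (Finset.sum_le_sum fun k _ => ?_)
        rw [Matrix.smul_apply, smul_eq_mul, abs_mul]
    _ = ∑ k, |x k| * ∑ j, |T k i j| := by
        rw [Finset.sum_comm]
        simp only [Finset.mul_sum]
    _ ≤ _ := by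
        rw [Finset.sum_mul]
        exact Finset.sum_le_sum fun k _ => mul_le_mul_of_nonneg_left (hT k i) (abs_nonneg _)

variable [DecidableEq ι]

/-- The symmetric matrix `R^{1/2} B R^{1/2}`, similar to `B R` when `R` is positive definite. -/
def conjSqrt (R B : Matrix ι ι ℝ) : Matrix ι ι ℝ := CFC.sqrt R * B * CFC.sqrt R

lemma transpose_sqrt (R : Matrix ι ι ℝ) : (CFC.sqrt R)ᵀ = CFC.sqrt R := by
  have h := (CFC.sqrt_nonneg R).isSelfAdjoint
  rwa [IsSelfAdjoint, star_eq_conjTranspose, conjTranspose_eq_transpose_of_trivial] at h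

lemma isHermitian_conjSqrt (R : Matrix ι ι ℝ) {B : Matrix ι ι ℝ} (hB : B.IsSymm) :
    (conjSqrt R B).IsHermitian := by
  rw [IsHermitian, conjTranspose_eq_transpose_of_trivial, conjSqrt, transpose_mul, transpose_mul,
    transpose_sqrt, hB.eq, Matrix.mul_assoc]

/-- `(R^{1/2} x)ᵀ B (R^{1/2} x) = xᵀ (R^{1/2} B R^{1/2}) x`. -/
lemma quadForm_sqrt_mulVec (R B : Matrix ι ι ℝ) (x : ι → ℝ) :
    (CFC.sqrt R *ᵥ x) ⬝ᵥ B *ᵥ (CFC.sqrt R *ᵥ x) = x ⬝ᵥ conjSqrt R B *ᵥ x := by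
  rw [conjSqrt, ← mulVec_mulVec, ← mulVec_mulVec, dotProduct_mulVec x, ← mulVec_transpose,
    transpose_sqrt]

lemma trace_sq_eq_sum_eigenvalues {H : Matrix ι ι ℝ} (hH : H.IsHermitian) :
    (H * H).trace = ∑ i, hH.eigenvalues i ^ 2 := by
  have h : H = (hH.eigenvectorUnitary : Matrix ι ι ℝ) * diagonal hH.eigenvalues *
      star (hH.eigenvectorUnitary : Matrix ι ι ℝ) := by
    conv_lhs => rw [hH.spectral_theorem]
    simp [Unitary.conjStarAlgAut_apply]
  have hU : star (hH.eigenvectorUnitary : Matrix ι ι ℝ) * (hH.eigenvectorUnitary : Matrix ι ι ℝ)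
      = 1 := by simp
  conv_lhs => rw [h]
  rw [Matrix.mul_assoc _ (star _), ← Matrix.mul_assoc (star _), ← Matrix.mul_assoc (star _), hU,
    Matrix.one_mul, Matrix.mul_assoc, ← Matrix.mul_assoc (diagonal _), Matrix.trace_mul_comm,
    Matrix.mul_assoc, hU, Matrix.mul_one, diagonal_mul_diagonal, trace_diagonal]
  simp [pow_two]

lemma trace_mul_mul_mul_eq {R B : Matrix ι ι ℝ} (hR : R.PosSemidef) (hB : B.IsSymm) :
    (R * B * R * B).trace = ∑ i, (isHermitian_conjSqrt R hB).eigenvalues i ^ 2 := by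
  rw [← trace_sq_eq_sum_eigenvalues]
  have h := CFC.sqrt_mul_sqrt_self R hR.nonneg
  have h2 : conjSqrt R B * conjSqrt R B = CFC.sqrt R * (B * R * B * CFC.sqrt R) := by
    calc conjSqrt R B * conjSqrt R B
        = CFC.sqrt R * (B * (CFC.sqrt R * CFC.sqrt R) * B * CFC.sqrt R) := by
          simp only [conjSqrt, Matrix.mul_assoc]
      _ = _ := by rw [h]
  rw [h2, Matrix.trace_mul_comm (CFC.sqrt R), Matrix.mul_assoc _ (CFC.sqrt R), h,
    Matrix.trace_mul_comm _ R]
  simp only [Matrix.mul_assoc]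

/-- Row-sum bounds for `R` and `B` bound the eigenvalues of `R^{1/2} B R^{1/2}`. -/
lemma abs_eigenvalues_conjSqrt_le {R B : Matrix ι ι ℝ} (hR : R.PosSemidef) (hB : B.IsSymm)
    {CR CB : ℝ} (hCR : ∀ i, ∑ j, |R i j| ≤ CR) (hCB : ∀ i, ∑ j, |B i j| ≤ CB) (hCB0 : 0 ≤ CB)
    (i : ι) : |(isHermitian_conjSqrt R hB).eigenvalues i| ≤ CR * CB := by
  set u : ι → ℝ := ⇑((isHermitian_conjSqrt R hB).eigenvectorBasis i) with hu
  have huu : u ⬝ᵥ u = 1 := by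
    have := (isHermitian_conjSqrt R hB).eigenvectorBasis.inner_eq_one i
    rwa [EuclideanSpace.inner_eq_star_dotProduct, star_trivial] at this
  have hev : (isHermitian_conjSqrt R hB).eigenvalues i = u ⬝ᵥ conjSqrt R B *ᵥ u := by
    rw [(isHermitian_conjSqrt R hB).eigenvalues_eq, star_trivial]
    rfl
  have hRs : R.IsSymm := by
    have := hR.isHermitian
    rwa [IsHermitian, conjTranspose_eq_transpose_of_trivial] at this
  have h1 : (CFC.sqrt R *ᵥ u) ⬝ᵥ (CFC.sqrt R *ᵥ u) = u ⬝ᵥ R *ᵥ u := by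
    rw [dotProduct_mulVec, ← mulVec_transpose, transpose_sqrt, mulVec_mulVec,
      CFC.sqrt_mul_sqrt_self R hR.nonneg, dotProduct_comm]
  rw [hev, ← quadForm_sqrt_mulVec]
  refine (abs_quadForm_le hB hCB _).trans ?_
  rw [h1, mul_comm CR]
  refine mul_le_mul_of_nonneg_left ?_ hCB0
  have := (le_abs_self _).trans (abs_quadForm_le hRs hCR u)
  rwa [huu, mul_one] at this

end Matrix

/-! ### Characteristic function of a centred Gaussian quadratic form -/

section Gaussian

open Matrix Complex
open scoped MatrixOrder RealInnerProductSpace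

lemma integral_sq_gaussianReal : ∫ x, x ^ 2 ∂gaussianReal 0 1 = 1 := by
  have h := variance_fun_id_gaussianReal (μ := 0) (v := 1)
  rw [variance_eq_integral measurable_id'.aemeasurable] at h
  simpa using h

lemma integrable_pow_gaussianReal (k : ℕ) :
    Integrable (fun x : ℝ => x ^ k) (gaussianReal 0 1) := by
  have h := (memLp_id_gaussianReal (μ := 0) (v := 1) k)
  exact (h.integrable_norm_pow' ).mono' (by fun_prop) (ae_of_all _ fun x => by simp)

lemma integral_pow_four_gaussianReal : ∫ x, x ^ 4 ∂gaussianReal 0 1 = 3 := by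
  have h : iteratedDeriv 4 (mgf (fun x : ℝ => x) (gaussianReal 0 1)) 0 =
      ∫ x, x ^ 4 ∂gaussianReal 0 1 := by
    rw [iteratedDeriv_mgf_zero] <;> simp
  have hd : ∀ (p q : ℝ → ℝ), (∀ t, HasDerivAt p (q t) t) →
      deriv (fun t => p t * Real.exp (t ^ 2 / 2)) =
        fun t => (q t + t * p t) * Real.exp (t ^ 2 / 2) := by
    intro p q hpq
    funext t
    have h1 : HasDerivAt (fun t : ℝ => Real.exp (t ^ 2 / 2)) (Real.exp (t ^ 2 / 2) * t) t := by
      have := ((hasDerivAt_pow 2 t).div_const 2).exp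
      simpa using this
    rw [((hpq t).fun_mul h1).deriv]
    ring
  rw [← h, mgf_fun_id_gaussianReal]
  have e0 : (fun t : ℝ => Real.exp (0 * t + ((1 : NNReal) : ℝ) * t ^ 2 / 2)) =
      fun t => (1 : ℝ) * Real.exp (t ^ 2 / 2) := by
    funext t; simp
  rw [e0, iteratedDeriv_succ', iteratedDeriv_succ', iteratedDeriv_succ', iteratedDeriv_succ',
    iteratedDeriv_zero, hd (fun _ => 1) (fun _ => 0) (fun t => hasDerivAt_const t _),
    hd (fun t => 0 + t * 1) (fun _ => 1) (fun t => by simpa using hasDerivAt_id' t),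
    hd (fun t => 1 + t * (0 + t * 1)) (fun t => 2 * t)
      (fun t => by simpa [pow_two] using (hasDerivAt_pow 2 t).const_add 1),
    hd (fun t => 2 * t + t * (1 + t * (0 + t * 1))) (fun t => 3 + 3 * t ^ 2) (fun t => by
      have := ((hasDerivAt_id' t).const_mul 3).add (hasDerivAt_pow 3 t)
      convert! this using 1
      · funext u; simp; ring
      · simp)]
  simp

/-- The law of `(ξ² - 1) / √2` for `ξ` standard normal: the chi-square law with one degree of
freedom, centred and scaled to unit variance. -/
def chiSq : Measure ℝ := (gaussianReal 0 1).map fun x => (x ^ 2 - 1) / √2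

instance : IsProbabilityMeasure chiSq := Measure.isProbabilityMeasure_map (by fun_prop)

lemma charFun_chiSq_isLittleO :
    (fun t : ℝ => charFun chiSq t - exp (-(t : ℂ) ^ 2 / 2)) =o[𝓝 0] fun t : ℝ => t ^ 2 := by
  have i2 := integrable_pow_gaussianReal 2
  have i4 := integrable_pow_gaussianReal 4
  have h0 : ∫ x, (x ^ 2 - 1) / √2 ∂gaussianReal 0 1 = 0 := by
    rw [integral_div, integral_sub i2 (integrable_const _), integral_sq_gaussianReal]
    simp
  have h1 : ∫ x, ((fun x : ℝ => (x ^ 2 - 1) / √2) ^ 2) x ∂gaussianReal 0 1 = 1 := by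
    have : ∀ x : ℝ, ((fun x : ℝ => (x ^ 2 - 1) / √2) ^ 2) x = (x ^ 4 - 2 * x ^ 2 + 1) / 2 := by
      intro x
      rw [Pi.pow_apply, div_pow, Real.sq_sqrt (by norm_num)]
      ring
    simp only [this]
    rw [integral_div, integral_add (by fun_prop) (integrable_const _),
      integral_sub i4 (i2.const_mul 2), integral_const_mul, integral_sq_gaussianReal,
      integral_pow_four_gaussianReal]
    norm_num
  have h2 : (fun t : ℝ => charFun chiSq t - (1 - (t : ℂ) ^ 2 / 2)) =o[𝓝 0] fun t : ℝ => t ^ 2 := by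
    simpa only [chiSq, ofReal_pow] using taylor_charFun_two (by fun_prop) h0 h1
  have h3 : (fun t : ℝ => exp (-(t : ℂ) ^ 2 / 2) - (1 - (t : ℂ) ^ 2 / 2)) =o[𝓝 0]
      fun t : ℝ => t ^ 2 := by
    have hT : Tendsto (fun t : ℝ => -(t : ℂ) ^ 2 / 2) (𝓝 0) (𝓝 0) := by
      have : Continuous fun t : ℝ => -(t : ℂ) ^ 2 / 2 := by fun_prop
      simpa using this.tendsto 0
    have h4 := (hasDerivAt_iff_isLittleO.1 (hasDerivAt_exp 0)).comp_tendsto hT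
    simp only [Function.comp_def, sub_zero, exp_zero, smul_eq_mul, mul_one] at h4
    have h5 : (fun t : ℝ => -(t : ℂ) ^ 2 / 2) =O[𝓝 0] fun t : ℝ => t ^ 2 := by
      refine Asymptotics.IsBigO.of_bound 1 (Eventually.of_forall fun t => ?_)
      simp
      nlinarith [sq_nonneg t]
    refine (h4.trans_isBigO h5).congr_left fun t => ?_
    ring
  refine (h2.sub h3).congr_left fun t => ?_
  ring

lemma norm_prod_sub_prod_le {ι : Type*} (s : Finset ι) (a b : ι → ℂ) (ha : ∀ i, ‖a i‖ ≤ 1)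
    (hb : ∀ i, ‖b i‖ ≤ 1) : ‖∏ i ∈ s, a i - ∏ i ∈ s, b i‖ ≤ ∑ i ∈ s, ‖a i - b i‖ := by
  classical
  induction s using Finset.induction_on with
  | empty => simp
  | insert i s hi ih =>
    rw [Finset.prod_insert hi, Finset.prod_insert hi, Finset.sum_insert hi]
    have h1 : a i * ∏ j ∈ s, a j - b i * ∏ j ∈ s, b j =
        (a i - b i) * ∏ j ∈ s, a j + b i * (∏ j ∈ s, a j - ∏ j ∈ s, b j) := by ring
    have h2 : ‖∏ j ∈ s, a j‖ ≤ 1 := by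
      rw [norm_prod]
      exact Finset.prod_le_one (fun _ _ => norm_nonneg _) fun j _ => ha j
    rw [h1]
    refine (norm_add_le _ _).trans (add_le_add ?_ ?_)
    · rw [norm_mul]
      exact mul_le_of_le_one_right (norm_nonneg _) h2
    · rw [norm_mul]
      exact (mul_le_of_le_one_left (norm_nonneg _) (hb i)).trans ih

variable {ι : Type*} [Fintype ι] [DecidableEq ι]

/-- A Gaussian vector with covariance `R` in coordinates that diagonalise the quadratic form
`yᵀ B y`: the form becomes a weighted sum of squares of independent standard normal variables. -/
lemma exists_map_pi_eq_multivariateGaussian (R : Matrix ι ι ℝ) {B : Matrix ι ι ℝ}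
    (hB : B.IsSymm) :
    ∃ g : (ι → ℝ) → EuclideanSpace ℝ ι, Measurable g ∧
      multivariateGaussian 0 R = (Measure.pi fun _ : ι => gaussianReal 0 1).map g ∧
      ∀ x, (g x).ofLp ⬝ᵥ B *ᵥ (g x).ofLp =
        ∑ i, (isHermitian_conjSqrt R hB).eigenvalues i * x i ^ 2 := by
  set hH := isHermitian_conjSqrt R hB
  set b := hH.eigenvectorBasis
  refine ⟨fun x => toEuclideanCLM (𝕜 := ℝ) (CFC.sqrt R) (∑ i, x i • b i), by fun_prop, ?_, ?_⟩
  · rw [multivariateGaussian, stdGaussian_eq_map_pi_orthonormalBasis b,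
      Measure.map_map (by fun_prop) (by fun_prop)]
    simp [Function.comp_def]
  · intro x
    rw [ofLp_toEuclideanCLM, quadForm_sqrt_mulVec, ← inner_toEuclideanCLM, map_sum]
    have h : ∀ i, toEuclideanCLM (𝕜 := ℝ) (conjSqrt R B) (x i • b i) =
        (hH.eigenvalues i * x i) • b i := by
      intro i
      apply (WithLp.ofLp_injective 2)
      rw [ofLp_toEuclideanCLM, WithLp.ofLp_smul, mulVec_smul, hH.mulVec_eigenvectorBasis,
        WithLp.ofLp_smul, smul_smul, mul_comm]
    simp only [h]
    rw [b.orthonormal.inner_sum]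
    refine Finset.sum_congr rfl fun i _ => ?_
    simp
    ring

lemma integral_quadForm_gaussian (R : Matrix ι ι ℝ) {B : Matrix ι ι ℝ} (hB : B.IsSymm) :
    ∫ y : EuclideanSpace ℝ ι, y.ofLp ⬝ᵥ B *ᵥ y.ofLp ∂multivariateGaussian 0 R =
      ∑ i, (isHermitian_conjSqrt R hB).eigenvalues i := by
  obtain ⟨g, hg, hmap, hq⟩ := exists_map_pi_eq_multivariateGaussian R hB
  have hc : Continuous fun y : EuclideanSpace ℝ ι => y.ofLp ⬝ᵥ B *ᵥ y.ofLp := by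
    simp only [← inner_toEuclideanCLM]
    fun_prop
  rw [hmap, integral_map hg.aemeasurable hc.aestronglyMeasurable]
  simp only [hq]
  rw [integral_finsetSum]
  · refine Finset.sum_congr rfl fun i _ => ?_
    rw [integral_const_mul, integral_comp_eval (μ := fun _ : ι => gaussianReal 0 1)
      (f := fun u : ℝ => u ^ 2) (by fun_prop),
      integral_sq_gaussianReal, mul_one]
  · intro i _
    exact (integrable_comp_eval (μ := fun _ : ι => gaussianReal 0 1) (f := fun u : ℝ => u ^ 2)
      (integrable_pow_gaussianReal 2)).const_mul _

/-- The characteristic function of `yᵀ B y - E (yᵀ B y)` for a Gaussian vector `y` with covariance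
`R` factorises over the eigenvalues of `R^{1/2} B R^{1/2}`. -/
lemma integral_exp_quadForm_gaussian (R : Matrix ι ι ℝ) {B : Matrix ι ι ℝ} (hB : B.IsSymm)
    (c : ℝ) :
    ∫ y : EuclideanSpace ℝ ι, exp ((c * (y.ofLp ⬝ᵥ B *ᵥ y.ofLp -
        ∫ z : EuclideanSpace ℝ ι, z.ofLp ⬝ᵥ B *ᵥ z.ofLp ∂multivariateGaussian 0 R) : ℝ) * I)
        ∂multivariateGaussian 0 R =
      ∏ i, charFun chiSq (√2 * c * (isHermitian_conjSqrt R hB).eigenvalues i) := by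
  rw [integral_quadForm_gaussian R hB]
  obtain ⟨g, hg, hmap, hq⟩ := exists_map_pi_eq_multivariateGaussian R hB
  set l := (isHermitian_conjSqrt R hB).eigenvalues
  have hc : Continuous fun y : EuclideanSpace ℝ ι =>
      exp ((c * (y.ofLp ⬝ᵥ B *ᵥ y.ofLp - ∑ i, l i) : ℝ) * I) := by
    simp only [← inner_toEuclideanCLM]
    fun_prop
  rw [hmap, integral_map hg.aemeasurable hc.aestronglyMeasurable]
  have h : ∀ x : ι → ℝ, exp ((c * ((g x).ofLp ⬝ᵥ B *ᵥ (g x).ofLp - ∑ i, l i) : ℝ) * I) =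
      ∏ i, exp (((√2 * c * l i : ℝ) : ℂ) * (((x i ^ 2 - 1) / √2 : ℝ) : ℂ) * I) := by
    intro x
    rw [hq, ← exp_sum, ← Finset.sum_sub_distrib, Finset.mul_sum, ofReal_sum, Finset.sum_mul]
    congr 1
    refine Finset.sum_congr rfl fun i _ => ?_
    rw [← ofReal_mul]
    congr 2
    field_simp
  simp only [h]
  rw [integral_fintype_prod_eq_prod (f := fun i (u : ℝ) =>
    exp (((√2 * c * l i : ℝ) : ℂ) * (((u ^ 2 - 1) / √2 : ℝ) : ℂ) * I))]
  refine Finset.prod_congr rfl fun i _ => ?_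
  rw [charFun_apply_real, chiSq, integral_map (by fun_prop) (by fun_prop)]

/-- A central limit estimate, uniform in the number of summands: if all weights `c l_i` are small,
the centred form `∑ c l_i (ξ_i² - 1)` has at `1` nearly the characteristic function of a normal
variable with the same variance `2 c² ∑ l_i²`. -/
lemma exists_norm_prod_charFun_chiSq_sub_le {ε : ℝ} (hε : 0 < ε) :
    ∃ δ > 0, ∀ {ι : Type} [Fintype ι] (c : ℝ) (l : ι → ℝ), (∀ i, |c * l i| ≤ δ) →
      ‖∏ i, charFun chiSq (√2 * c * l i) - exp (-((c ^ 2 * ∑ i, l i ^ 2 : ℝ) : ℂ))‖ ≤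
        ε * (c ^ 2 * ∑ i, l i ^ 2) := by
  have h := charFun_chiSq_isLittleO.bound (half_pos hε)
  obtain ⟨δ, hδ, hb⟩ := Metric.eventually_nhds_iff.1 h
  -- any bound below `δ / √2` will do
  refine ⟨δ / 4, by positivity, fun {ι} _ c l hl => ?_⟩
  have hexp : exp (-((c ^ 2 * ∑ i, l i ^ 2 : ℝ) : ℂ)) =
      ∏ i, exp (-((√2 * c * l i : ℝ) : ℂ) ^ 2 / 2) := by
    rw [← exp_sum, Finset.mul_sum, ofReal_sum, ← Finset.sum_neg_distrib]
    congr 1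
    refine Finset.sum_congr rfl fun i _ => ?_
    rw [← ofReal_pow, mul_pow, mul_pow, Real.sq_sqrt (by norm_num)]
    push_cast
    ring
  rw [hexp, Finset.mul_sum, Finset.mul_sum]
  refine (norm_prod_sub_prod_le _ _ _ (fun i => norm_charFun_le_one _) fun i => ?_).trans
    (Finset.sum_le_sum fun i _ => ?_)
  · rw [norm_exp, ← ofReal_pow, ← ofReal_neg, ← ofReal_ofNat, ← ofReal_div, ofReal_re]
    exact Real.exp_le_one_iff.2 (by nlinarith [sq_nonneg (√2 * c * l i)])
  · have h2 : √2 ≤ 2 := Real.sqrt_le_iff.2 ⟨by norm_num, by norm_num⟩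
    have h3 : dist (√2 * c * l i) 0 < δ := by
      rw [dist_zero_right, Real.norm_eq_abs, mul_assoc, abs_mul, abs_of_nonneg (Real.sqrt_nonneg 2)]
      nlinarith [hl i, abs_nonneg (c * l i)]
    refine (hb h3).trans (le_of_eq ?_)
    rw [Real.norm_of_nonneg (sq_nonneg _), mul_pow, mul_pow, Real.sq_sqrt (by norm_num)]
    ring

end Gaussian

/-! ### Weak convergence along a bounded sequence of covariance matrices -/

section Weak

open Matrix

variable {ι : Type*} [Fintype ι]

lemma posSemidef_of_tendsto {S : ℕ → Matrix ι ι ℝ} {S' : Matrix ι ι ℝ}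
    (hS : ∀ n, (S n).PosSemidef) (h : Tendsto S atTop (𝓝 S')) : S'.PosSemidef := by
  refine PosSemidef.of_dotProduct_mulVec_nonneg ?_ fun x => ?_
  · have h1 : Tendsto (fun n => (S n)ᴴ) atTop (𝓝 S'ᴴ) :=
      (continuous_id.matrix_conjTranspose.tendsto S').comp h
    exact tendsto_nhds_unique h1 (h.congr fun n => (hS n).isHermitian.symm)
  · have h1 : Continuous fun M : Matrix ι ι ℝ => star x ⬝ᵥ M *ᵥ x := by fun_prop
    exact ge_of_tendsto' ((h1.tendsto S').comp h) fun n => (hS n).dotProduct_mulVec_nonneg x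

variable [DecidableEq ι]

lemma charFun_normal {S : Matrix ι ι ℝ} (hS : S.PosSemidef) (t : EuclideanSpace ℝ ι) :
    charFun (normal S : Measure (EuclideanSpace ℝ ι)) t =
      Complex.exp (-((t.ofLp ⬝ᵥ S *ᵥ t.ofLp : ℝ) : ℂ) / 2) := by
  rw [normal, ProbabilityMeasure.coe_mk, charFun_multivariateGaussian hS]
  simp [neg_div]

/-- If the characteristic functions of `Q_n` and of `N(0, S_n)` become close pointwise, and the
covariance matrices `S_n` are bounded, then `Q_n` and `N(0, S_n)` become close in every metric for
weak convergence. Neither sequence need converge; along a subsequence on which `S_n` does,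
Lévy's theorem shows that both have the same limit. -/
lemma tendsto_dist_normal {Q : ℕ → ProbabilityMeasure (EuclideanSpace ℝ ι)}
    {S : ℕ → Matrix ι ι ℝ} (hS : ∀ n, (S n).PosSemidef) {C : ℝ} (hC : ∀ n i j, |S n i j| ≤ C)
    (h : ∀ t, Tendsto (fun n => charFun (Q n : Measure (EuclideanSpace ℝ ι)) t -
      charFun (normal (S n) : Measure (EuclideanSpace ℝ ι)) t) atTop (𝓝 0))
    (m : MetricSpace (ProbabilityMeasure (EuclideanSpace ℝ ι))) (hm : GeneratesWeakTopology m) :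
    Tendsto (fun n => m.dist (Q n) (normal (S n))) atTop (𝓝 0) := by
  refine tendsto_of_subseq_tendsto fun ns hns => ?_
  have hK : IsCompact (Set.univ.pi fun _ : ι => Set.univ.pi fun _ : ι => Set.Icc (-C) C) :=
    isCompact_univ_pi fun _ => isCompact_univ_pi fun _ => isCompact_Icc
  obtain ⟨S', φ, hφ, hlim⟩ : ∃ (S' : Matrix ι ι ℝ) (φ : ℕ → ℕ), StrictMono φ ∧
      Tendsto (fun n => S (ns (φ n))) atTop (𝓝 S') := by
    obtain ⟨S', -, φ, hφ, hlim⟩ := hK.tendsto_subseq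
      (x := fun n => (fun i j => S (ns n) i j : ι → ι → ℝ)) fun n i _ j _ =>
        abs_le.1 (hC (ns n) i j)
    exact ⟨S', φ, hφ, hlim⟩
  have hS' : Matrix.PosSemidef S' := posSemidef_of_tendsto (fun n => hS (ns (φ n))) hlim
  refine ⟨φ, ?_⟩
  have hN : ∀ t, Tendsto (fun n => charFun (normal (S (ns (φ n))) : Measure (EuclideanSpace ℝ ι)) t)
      atTop (𝓝 (charFun (normal S' : Measure (EuclideanSpace ℝ ι)) t)) := by
    intro t
    simp only [charFun_normal hS', charFun_normal (hS _)]
    have hc : Continuous fun M : Matrix ι ι ℝ =>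
        Complex.exp (-((t.ofLp ⬝ᵥ M *ᵥ t.ofLp : ℝ) : ℂ) / 2) := by fun_prop
    exact (hc.tendsto S').comp hlim
  have hNw : Tendsto (fun n => normal (S (ns (φ n)))) atTop (𝓝 (normal S')) :=
    ProbabilityMeasure.tendsto_iff_tendsto_charFun.2 hN
  have hQw : Tendsto (fun n => Q (ns (φ n))) atTop (𝓝 (normal S')) := by
    refine ProbabilityMeasure.tendsto_iff_tendsto_charFun.2 fun t => ?_
    have := ((h t).comp (hns.comp hφ.tendsto_atTop)).add (hN t)
    simpa [Function.comp_def] using this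
  have transfer : ∀ (u : ℕ → ProbabilityMeasure (EuclideanSpace ℝ ι)) (μ),
      Tendsto u atTop (𝓝 μ) →
        Tendsto u atTop (@nhds _ m.toPseudoMetricSpace.toUniformSpace.toTopologicalSpace μ) := by
    intro u μ hu
    rw [show m.toPseudoMetricSpace.toUniformSpace.toTopologicalSpace = weakTopology ι from hm]
    exact hu
  have := @Filter.Tendsto.dist _ _ m.toPseudoMetricSpace _ _ _ _ _ (transfer _ _ hQw)
    (transfer _ _ hNw)
  rwa [@dist_self _ m.toPseudoMetricSpace] at this

end Weak

/-! ### The vector of observations -/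

section Observations

open Matrix
open scoped RealInnerProductSpace

variable {𝓤 : Type*} [MeasurableSpace 𝓤] {P : Measure 𝓤} {d p n : ℕ}

/-- The vector `y` of all observations, with entry `X_a(s_i)` at `(i, a)`. -/
def obsVec (X : Fin p → EuclideanSpace ℝ (Fin d) → 𝓤 → ℝ) (s : Fin n → EuclideanSpace ℝ (Fin d))
    (ω : 𝓤) : EuclideanSpace ℝ (Fin n × Fin p) :=
  WithLp.toLp 2 fun ia => X ia.2 (s ia.1) ω

variable {Z : Fin p → EuclideanSpace ℝ (Fin d) → 𝓤 → ℝ} {K : Fin p → EuclideanSpace ℝ (Fin d) → ℝ}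

lemma memLp_latent (hZ : IsLatentField P Z K) (k : Fin p) (x : EuclideanSpace ℝ (Fin d)) :
    MemLp (Z k x) 2 P :=
  ((hZ.gaussian k).hasGaussianLaw_eval x).memLp_two

lemma memLp_obs (hZ : IsLatentField P Z K) (Ω : Matrix (Fin p) (Fin p) ℝ) (a : Fin p)
    (x : EuclideanSpace ℝ (Fin d)) : MemLp (obs Ω Z a x) 2 P :=
  memLp_finsetSum _ fun k _ => (memLp_latent hZ k x).const_mul _

lemma integral_obs [IsProbabilityMeasure P] (hZ : IsLatentField P Z K)
    (Ω : Matrix (Fin p) (Fin p) ℝ) (a : Fin p) (x : EuclideanSpace ℝ (Fin d)) :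
    ∫ ω, obs Ω Z a x ω ∂P = 0 := by
  simp only [obs]
  rw [integral_finsetSum _ fun k _ => ((memLp_latent hZ k x).integrable one_le_two).const_mul _]
  simp [integral_const_mul, hZ.mean_zero]

lemma covariance_latent [IsProbabilityMeasure P] (hZ : IsLatentField P Z K) (k l : Fin p)
    (x y : EuclideanSpace ℝ (Fin d)) :
    covariance (Z k x) (Z l y) P = if k = l then K k (x - y) else 0 := by
  split_ifs with h
  · rw [← h, hZ.cov_eq]
  · have h1 : IndepFun (Z k x) (Z l y) P :=
      (hZ.indep.indepFun h).comp (measurable_pi_apply x) (measurable_pi_apply y)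
    exact h1.covariance_eq_zero (memLp_latent hZ k x) (memLp_latent hZ l y)

lemma covariance_obs [IsProbabilityMeasure P] (hZ : IsLatentField P Z K)
    (Ω : Matrix (Fin p) (Fin p) ℝ) (a b : Fin p) (x y : EuclideanSpace ℝ (Fin d)) :
    covariance (obs Ω Z a x) (obs Ω Z b y) P = ∑ k, Ω a k * Ω b k * K k (x - y) := by
  have h : ∀ a x, obs Ω Z a x = fun ω => ∑ k, (fun ω => Ω a k * Z k x ω) ω := fun a x => rfl
  rw [h, h, covariance_fun_sum_fun_sum (fun k => (memLp_latent hZ k x).const_mul _)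
    (fun k => (memLp_latent hZ k y).const_mul _)]
  simp only [covariance_const_mul_left, covariance_const_mul_right, covariance_latent hZ]
  simp only [mul_ite, mul_zero, Finset.sum_ite_eq, Finset.mem_univ, if_true]
  exact Finset.sum_congr rfl fun k _ => by ring

lemma hasGaussianLaw_obsVec [IsProbabilityMeasure P] (hZ : IsLatentField P Z K)
    (Ω : Matrix (Fin p) (Fin p) ℝ) (s : Fin n → EuclideanSpace ℝ (Fin d)) :
    HasGaussianLaw (obsVec (obs Ω Z) s) P := by
  have h1 : ∀ k, HasGaussianLaw (fun ω (i : Fin n) => Z k (s i) ω) P := by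
    intro k
    have h := ((hZ.gaussian k).comp_right s).hasGaussianLaw Finset.univ
    let L : (↥(Finset.univ : Finset (Fin n)) → ℝ) →L[ℝ] (Fin n → ℝ) :=
      ContinuousLinearMap.pi fun i => ContinuousLinearMap.proj ⟨i, Finset.mem_univ i⟩
    exact h.map_fun L
  have h2 : iIndepFun (fun k ω (i : Fin n) => Z k (s i) ω) P :=
    hZ.indep.comp (fun _ z i => z (s i)) fun _ =>
      measurable_pi_lambda _ fun i => measurable_pi_apply (s i)
  have h3 := iIndepFun.hasGaussianLaw h1 h2
  let L : (Fin p → Fin n → ℝ) →L[ℝ] (Fin n × Fin p → ℝ) :=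
    ContinuousLinearMap.pi fun ia => ∑ k, Ω ia.2 k •
      ((ContinuousLinearMap.proj (R := ℝ) (φ := fun _ : Fin n => ℝ) ia.1).comp
        (ContinuousLinearMap.proj (R := ℝ) (φ := fun _ : Fin p => Fin n → ℝ) k) :
          (Fin p → Fin n → ℝ) →L[ℝ] ℝ)
  have h4 := (h3.map_fun L).map_fun
    (PiLp.continuousLinearEquiv 2 ℝ (fun _ : Fin n × Fin p => ℝ)).symm.toContinuousLinearMap
  convert! h4 using 1
  funext ω
  ext ia
  simp [obsVec, obs, L]

lemma covarianceBilin_map_obsVec [IsProbabilityMeasure P] (hZ : IsLatentField P Z K)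
    (Ω : Matrix (Fin p) (Fin p) ℝ) (s : Fin n → EuclideanSpace ℝ (Fin d))
    (x y : EuclideanSpace ℝ (Fin n × Fin p)) :
    covarianceBilin (P.map (obsVec (obs Ω Z) s)) x y =
      x.ofLp ⬝ᵥ R P (obs Ω Z) s *ᵥ y.ofLp := by
  have h := covarianceBilin_apply_pi (μ := P)
    (X := fun ia : Fin n × Fin p => obs Ω Z ia.2 (s ia.1)) (fun ia => memLp_obs hZ Ω _ _) x y
  refine h.trans ?_
  simp only [dotProduct, mulVec, R, of_apply, Finset.mul_sum]
  exact Finset.sum_congr rfl fun i _ => Finset.sum_congr rfl fun j _ => by ring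

lemma posSemidef_R [IsProbabilityMeasure P] (hZ : IsLatentField P Z K)
    (Ω : Matrix (Fin p) (Fin p) ℝ) (s : Fin n → EuclideanSpace ℝ (Fin d)) :
    (R P (obs Ω Z) s).PosSemidef := by
  refine PosSemidef.of_dotProduct_mulVec_nonneg ?_ fun x => ?_
  · ext i j
    simp [R, conjTranspose_apply, covariance_comm]
  · have h := covarianceBilin_self_nonneg (μ := P.map (obsVec (obs Ω Z) s)) (WithLp.toLp 2 x)
    rwa [covarianceBilin_map_obsVec hZ] at h

lemma map_obsVec [IsProbabilityMeasure P] (hZ : IsLatentField P Z K)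
    (Ω : Matrix (Fin p) (Fin p) ℝ) (s : Fin n → EuclideanSpace ℝ (Fin d)) :
    P.map (obsVec (obs Ω Z) s) = multivariateGaussian 0 (R P (obs Ω Z) s) := by
  have hG := hasGaussianLaw_obsVec hZ Ω s
  have := hG.isGaussian_map
  apply IsGaussian.ext
  · simp only [id_eq, integral_id_multivariateGaussian]
    rw [integral_map hG.aemeasurable (by fun_prop)]
    ext ia
    rw [eval_integral_piLp fun ia => (memLp_obs hZ Ω ia.2 (s ia.1)).integrable one_le_two]
    exact integral_obs hZ Ω ia.2 (s ia.1)
  · ext x y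
    rw [covarianceBilin_map_obsVec hZ, covarianceBilin_multivariateGaussian (posSemidef_R hZ Ω s)]

/-! ### Local covariance matrices as quadratic forms -/

lemma isSymm_T (s : Fin n → EuclideanSpace ℝ (Fin d)) (f : EuclideanSpace ℝ (Fin d) → ℝ)
    (b l : Fin p) : (T s f b l).IsSymm := by
  ext ia jc
  simp only [transpose_apply, T, of_apply, Matrix.smul_apply, Matrix.add_apply, smul_eq_mul,
    single_apply]
  rw [add_comm]
  simp only [and_comm]

lemma Mhat_eq_quadForm {𝓤 : Type*} (X : Fin p → EuclideanSpace ℝ (Fin d) → 𝓤 → ℝ)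
    (s : Fin n → EuclideanSpace ℝ (Fin d)) (f : EuclideanSpace ℝ (Fin d) → ℝ) (ω : 𝓤)
    (b l : Fin p) :
    Mhat X s f ω b l =
      (n : ℝ)⁻¹ * ((obsVec X s ω).ofLp ⬝ᵥ T s f b l *ᵥ (obsVec X s ω).ofLp) := by
  have h : (obsVec X s ω).ofLp ⬝ᵥ T s f b l *ᵥ (obsVec X s ω).ofLp =
      ∑ i, ∑ j, (1 / 2 * (f (s i - s j) * (X b (s i) ω * X l (s j) ω)) +
        1 / 2 * (f (s j - s i) * (X b (s j) ω * X l (s i) ω))) := by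
    simp only [dotProduct, mulVec, Fintype.sum_prod_type, T, of_apply, Matrix.smul_apply,
      Matrix.add_apply, smul_eq_mul, single_apply, obsVec]
    refine Finset.sum_congr rfl fun i _ => ?_
    simp only [Finset.mul_sum]
    rw [Finset.sum_comm]
    refine Finset.sum_congr rfl fun j _ => ?_
    simp only [mul_add, add_mul, Finset.sum_add_distrib, ite_and, mul_ite, ite_mul, mul_zero,
      zero_mul, mul_one, Finset.sum_ite_eq, Finset.sum_ite_irrel, Finset.sum_const_zero,
      Finset.mem_univ, if_true]
    ring
  rw [Mhat, of_apply, h]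
  congr 1
  simp only [Finset.sum_add_distrib]
  rw [Finset.sum_comm (f := fun i j => 1 / 2 * (f (s j - s i) * (X b (s j) ω * X l (s i) ω))),
    ← Finset.sum_add_distrib]
  refine Finset.sum_congr rfl fun i _ => ?_
  rw [← Finset.sum_add_distrib]
  exact Finset.sum_congr rfl fun j _ => by ring

lemma integrable_obs_mul [IsProbabilityMeasure P] (hZ : IsLatentField P Z K)
    (Ω : Matrix (Fin p) (Fin p) ℝ) (a b : Fin p) (x y : EuclideanSpace ℝ (Fin d)) :
    Integrable (fun ω => obs Ω Z a x ω * obs Ω Z b y ω) P :=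
  (memLp_obs hZ Ω a x).integrable_mul (memLp_obs hZ Ω b y)

lemma Mpop_eq_integral [IsProbabilityMeasure P] (hZ : IsLatentField P Z K)
    (Ω : Matrix (Fin p) (Fin p) ℝ) (s : Fin n → EuclideanSpace ℝ (Fin d))
    (f : EuclideanSpace ℝ (Fin d) → ℝ) (a b : Fin p) :
    Mpop P (obs Ω Z) s f a b = ∫ ω, Mhat (obs Ω Z) s f ω a b ∂P := by
  simp only [Mhat, Mpop, of_apply]
  rw [integral_const_mul, integral_finsetSum _ fun i _ => integrable_finsetSum _ fun j _ =>
    (integrable_obs_mul hZ Ω a b _ _).const_mul _]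
  congr 1
  refine Finset.sum_congr rfl fun i _ => ?_
  rw [integral_finsetSum _ fun j _ => (integrable_obs_mul hZ Ω a b _ _).const_mul _]
  exact Finset.sum_congr rfl fun j _ => (integral_const_mul _ _).symm

/-- The symmetric matrices of the quadratic forms `n Mhat(f)` and `n Mhat(g)`, indexed by the
coordinates of `(W(f)ᵀ, W(g)ᵀ)ᵀ`. -/
def formMatrix (s : Fin n → EuclideanSpace ℝ (Fin d)) (f g : EuclideanSpace ℝ (Fin d) → ℝ) :
    Idx p → Matrix (Fin n × Fin p) (Fin n × Fin p) ℝ :=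
  Sum.elim (fun bl => T s f bl.1 bl.2) fun bl => T s g bl.1 bl.2

lemma isSymm_formMatrix (s : Fin n → EuclideanSpace ℝ (Fin d))
    (f g : EuclideanSpace ℝ (Fin d) → ℝ) (k : Idx p) : (formMatrix s f g k).IsSymm := by
  cases k <;> exact isSymm_T _ _ _ _

lemma V_eq (P : Measure 𝓤) (X : Fin p → EuclideanSpace ℝ (Fin d) → 𝓤 → ℝ)
    (s : Fin n → EuclideanSpace ℝ (Fin d)) (f g : EuclideanSpace ℝ (Fin d) → ℝ) :
    V P X s f g = Matrix.of fun k l => 2 * (n : ℝ)⁻¹ *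
      (R P X s * formMatrix s f g k * R P X s * formMatrix s f g l).trace := by
  ext k l
  cases k <;> cases l <;> rfl

/-- The symmetric matrix of the quadratic form `√n ⟨t, (W(f)ᵀ, W(g)ᵀ)ᵀ⟩`, up to centring. -/
def combMatrix (s : Fin n → EuclideanSpace ℝ (Fin d)) (f g : EuclideanSpace ℝ (Fin d) → ℝ)
    (t : Idx p → ℝ) : Matrix (Fin n × Fin p) (Fin n × Fin p) ℝ :=
  ∑ k, t k • formMatrix s f g k

lemma isSymm_combMatrix (s : Fin n → EuclideanSpace ℝ (Fin d))
    (f g : EuclideanSpace ℝ (Fin d) → ℝ) (t : Idx p → ℝ) : (combMatrix s f g t).IsSymm :=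
  isSymm_sum_smul (isSymm_formMatrix s f g) t

lemma jointW_apply [IsProbabilityMeasure P] (hZ : IsLatentField P Z K)
    (Ω : Matrix (Fin p) (Fin p) ℝ) (s : Fin n → EuclideanSpace ℝ (Fin d))
    (f g : EuclideanSpace ℝ (Fin d) → ℝ) (ω : 𝓤) (k : Idx p) :
    jointW P (obs Ω Z) s f g ω k = √(n : ℝ) * (n : ℝ)⁻¹ *
      ((obsVec (obs Ω Z) s ω).ofLp ⬝ᵥ formMatrix s f g k *ᵥ (obsVec (obs Ω Z) s ω).ofLp -
        ∫ ω, (obsVec (obs Ω Z) s ω).ofLp ⬝ᵥ formMatrix s f g k *ᵥ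
          (obsVec (obs Ω Z) s ω).ofLp ∂P) := by
  have h : ∀ (f : EuclideanSpace ℝ (Fin d) → ℝ) (b l : Fin p), W P (obs Ω Z) s f ω (b, l) =
      √(n : ℝ) * (n : ℝ)⁻¹ *
        ((obsVec (obs Ω Z) s ω).ofLp ⬝ᵥ T s f b l *ᵥ (obsVec (obs Ω Z) s ω).ofLp -
          ∫ ω, (obsVec (obs Ω Z) s ω).ofLp ⬝ᵥ T s f b l *ᵥ (obsVec (obs Ω Z) s ω).ofLp ∂P) := by
    intro f b l
    simp only [W, Mpop_eq_integral hZ, Mhat_eq_quadForm]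
    rw [integral_const_mul]
    ring
  rcases k with ⟨b, l⟩ | ⟨b, l⟩
  · exact h f b l
  · exact h g b l

lemma quadForm_sum_smul {ι κ : Type*} [Fintype ι] [Fintype κ] (T : κ → Matrix ι ι ℝ) (t : κ → ℝ)
    (y : ι → ℝ) : y ⬝ᵥ (∑ k, t k • T k) *ᵥ y = ∑ k, t k * (y ⬝ᵥ T k *ᵥ y) := by
  rw [sum_mulVec, dotProduct_sum]
  simp [smul_mulVec, dotProduct_smul]

lemma inner_jointW [IsProbabilityMeasure P] (hZ : IsLatentField P Z K)
    (Ω : Matrix (Fin p) (Fin p) ℝ) (s : Fin n → EuclideanSpace ℝ (Fin d))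
    (f g : EuclideanSpace ℝ (Fin d) → ℝ) (t : EuclideanSpace ℝ (Idx p)) (ω : 𝓤) :
    ⟪jointW P (obs Ω Z) s f g ω, t⟫ = √(n : ℝ) * (n : ℝ)⁻¹ *
      ((obsVec (obs Ω Z) s ω).ofLp ⬝ᵥ combMatrix s f g t.ofLp *ᵥ (obsVec (obs Ω Z) s ω).ofLp -
        ∫ z : EuclideanSpace ℝ (Fin n × Fin p), z.ofLp ⬝ᵥ combMatrix s f g t.ofLp *ᵥ z.ofLp
          ∂multivariateGaussian 0 (R P (obs Ω Z) s)) := by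
  have hint : ∀ k, Integrable (fun ω => (obsVec (obs Ω Z) s ω).ofLp ⬝ᵥ formMatrix s f g k *ᵥ
      (obsVec (obs Ω Z) s ω).ofLp) P := by
    intro k
    simp only [dotProduct, mulVec, Finset.mul_sum]
    refine integrable_finsetSum _ fun i _ => integrable_finsetSum _ fun j _ => ?_
    exact ((integrable_obs_mul hZ Ω i.2 j.2 (s i.1) (s j.1)).const_mul
      (formMatrix s f g k i j)).congr (ae_of_all _ fun ω => by simp [obsVec]; ring)
  rw [← map_obsVec hZ, integral_map (hasGaussianLaw_obsVec hZ Ω s).aemeasurable (by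
    refine Continuous.aestronglyMeasurable ?_
    simp only [← inner_toEuclideanCLM]
    fun_prop)]
  simp only [combMatrix, quadForm_sum_smul]
  rw [integral_finsetSum _ fun k _ => (hint k).const_mul _, ← Finset.sum_sub_distrib,
    PiLp.inner_apply, Finset.mul_sum]
  refine Finset.sum_congr rfl fun k _ => ?_
  rw [jointW_apply hZ, integral_const_mul]
  simp
  ring

lemma charFun_Q [IsProbabilityMeasure P] (hZ : IsLatentField P Z K)
    (Ω : Matrix (Fin p) (Fin p) ℝ) (s : Fin n → EuclideanSpace ℝ (Fin d))
    (f g : EuclideanSpace ℝ (Fin d) → ℝ) (t : EuclideanSpace ℝ (Idx p)) :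
    charFun (Q P hZ Ω s f g : Measure (EuclideanSpace ℝ (Idx p))) t =
      ∏ i, charFun chiSq (√2 * (√(n : ℝ) * (n : ℝ)⁻¹) *
        (isHermitian_conjSqrt (R P (obs Ω Z) s)
          (isSymm_combMatrix s f g t.ofLp)).eigenvalues i) := by
  have hc : Continuous fun y : EuclideanSpace ℝ (Fin n × Fin p) =>
      Complex.exp ((√(n : ℝ) * (n : ℝ)⁻¹ * (y.ofLp ⬝ᵥ combMatrix s f g t.ofLp *ᵥ y.ofLp -
        ∫ z : EuclideanSpace ℝ (Fin n × Fin p), z.ofLp ⬝ᵥ combMatrix s f g t.ofLp *ᵥ z.ofLp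
          ∂multivariateGaussian 0 (R P (obs Ω Z) s)) : ℝ) * Complex.I) := by
    simp only [← inner_toEuclideanCLM]
    fun_prop
  rw [← integral_exp_quadForm_gaussian _ (isSymm_combMatrix s f g t.ofLp), charFun_apply, Q,
    ProbabilityMeasure.coe_mk,
    integral_map (measurable_jointW P (measurable_obs hZ Ω) s f g).aemeasurable (by fun_prop)]
  simp only [inner_jointW hZ]
  rw [← integral_map (hasGaussianLaw_obsVec hZ Ω s).aemeasurable hc.aestronglyMeasurable,
    map_obsVec hZ]

/-- `tᵀ V t` is `2 / n` times the sum of squared eigenvalues of `R^{1/2} B R^{1/2}`, where `B` is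
the matrix of the combination of quadratic forms with coefficients `t`. -/
lemma quadForm_V [IsProbabilityMeasure P] (hZ : IsLatentField P Z K)
    (Ω : Matrix (Fin p) (Fin p) ℝ) (s : Fin n → EuclideanSpace ℝ (Fin d))
    (f g : EuclideanSpace ℝ (Fin d) → ℝ) (t : Idx p → ℝ) :
    t ⬝ᵥ V P (obs Ω Z) s f g *ᵥ t = 2 * (n : ℝ)⁻¹ *
      ∑ i, (isHermitian_conjSqrt (R P (obs Ω Z) s)
        (isSymm_combMatrix s f g t)).eigenvalues i ^ 2 := by
  rw [V_eq, quadForm_trace, ← trace_mul_mul_mul_eq (posSemidef_R hZ Ω s)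
    (isSymm_combMatrix s f g t)]
  rfl

lemma posSemidef_V [IsProbabilityMeasure P] (hZ : IsLatentField P Z K)
    (Ω : Matrix (Fin p) (Fin p) ℝ) (s : Fin n → EuclideanSpace ℝ (Fin d))
    (f g : EuclideanSpace ℝ (Fin d) → ℝ) : (V P (obs Ω Z) s f g).PosSemidef := by
  refine PosSemidef.of_dotProduct_mulVec_nonneg ?_ fun t => ?_
  · rw [V_eq]
    ext k l
    simp only [conjTranspose_apply, of_apply, star_trivial]
    rw [Matrix.mul_assoc, Matrix.trace_mul_comm, ← Matrix.mul_assoc]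
  · rw [star_trivial, quadForm_V hZ]
    positivity

/-! ### Bounds uniform in the sample size -/

/-- Entrywise decay in the distance of the points bounds the absolute row sums. -/
lemma sum_abs_le_of_decay {s : Fin n → EuclideanSpace ℝ (Fin d)} {r C D : ℝ} (hD : 0 ≤ D)
    (hC : ∀ x, ∑ j, 1 / (1 + ‖x - s j‖ ^ r) ≤ C)
    {M : Matrix (Fin n × Fin p) (Fin n × Fin p) ℝ}
    (hM : ∀ ia jc, |M ia jc| ≤ D * (1 / (1 + ‖s ia.1 - s jc.1‖ ^ r))) (ia : Fin n × Fin p) :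
    ∑ jc, |M ia jc| ≤ p * (D * C) := by
  refine (Finset.sum_le_sum fun jc _ => hM ia jc).trans ?_
  rw [Fintype.sum_prod_type]
  simp only [Finset.sum_const, Finset.card_univ, Fintype.card_fin, nsmul_eq_mul]
  rw [← Finset.mul_sum, ← Finset.mul_sum]
  gcongr
  exact hC _

lemma abs_T_le (s : Fin n → EuclideanSpace ℝ (Fin d)) {f : EuclideanSpace ℝ (Fin d) → ℝ}
    {A α : ℝ} (hf : HasDecay A α f) (b l : Fin p) (ia jc : Fin n × Fin p) :
    |T s f b l ia jc| ≤ A * (1 / (1 + ‖s ia.1 - s jc.1‖ ^ ((d : ℝ) + α))) := by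
  have h1 := hf (s ia.1 - s jc.1)
  have h2 := hf (s jc.1 - s ia.1)
  rw [norm_sub_rev] at h2
  have h3 : ∀ (u v : Fin p), |Matrix.single u v (1 : ℝ) ia.2 jc.2| ≤ 1 := by
    intro u v
    rw [single_apply]
    split_ifs <;> simp
  simp only [T, of_apply, Matrix.smul_apply, Matrix.add_apply, smul_eq_mul]
  rw [mul_one_div, abs_mul, abs_of_pos (by norm_num : (0 : ℝ) < 1 / 2)]
  have h4 := abs_add_le (f (s ia.1 - s jc.1) * Matrix.single b l (1 : ℝ) ia.2 jc.2)
    (f (s jc.1 - s ia.1) * Matrix.single l b (1 : ℝ) ia.2 jc.2)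
  rw [abs_mul, abs_mul] at h4
  have h5 := mul_le_of_le_one_right (abs_nonneg (f (s ia.1 - s jc.1))) (h3 b l)
  have h6 := mul_le_of_le_one_right (abs_nonneg (f (s jc.1 - s ia.1))) (h3 l b)
  linarith

lemma hasDecay_f₀ {α : ℝ} (hα : 0 < α) : HasDecay (d := d) 1 α f₀ := by
  intro x
  have hr : (d : ℝ) + α ≠ 0 := by positivity
  by_cases h : x = 0
  · simp [f₀, h, Real.zero_rpow hr]
  · simp only [f₀, h, if_false, abs_zero]
    positivity

lemma abs_R_le [IsProbabilityMeasure P] (hZ : IsLatentField P Z K)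
    (Ω : Matrix (Fin p) (Fin p) ℝ) (s : Fin n → EuclideanSpace ℝ (Fin d)) {A α : ℝ} (hA : 0 < A)
    (hK : ∀ k, HasDecay A α (K k)) (ia jc : Fin n × Fin p) :
    |R P (obs Ω Z) s ia jc| ≤ ((∑ a, ∑ b, ∑ k, |Ω a k| * |Ω b k|) * A) *
      (1 / (1 + ‖s ia.1 - s jc.1‖ ^ ((d : ℝ) + α))) := by
  rw [R, of_apply, covariance_obs hZ, mul_assoc, mul_one_div]
  have h0 : 0 ≤ A / (1 + ‖s ia.1 - s jc.1‖ ^ ((d : ℝ) + α)) := by positivity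
  calc |∑ k, Ω ia.2 k * Ω jc.2 k * K k (s ia.1 - s jc.1)|
      ≤ ∑ k, |Ω ia.2 k| * |Ω jc.2 k| * (A / (1 + ‖s ia.1 - s jc.1‖ ^ ((d : ℝ) + α))) := by
        refine (Finset.abs_sum_le_sum_abs _ _).trans (Finset.sum_le_sum fun k _ => ?_)
        rw [abs_mul, abs_mul]
        gcongr
        exact hK k _
    _ ≤ _ := by
        rw [← Finset.sum_mul]
        refine mul_le_mul_of_nonneg_right ?_ h0
        refine le_trans ?_ (Finset.single_le_sum (f := fun a => ∑ b, ∑ k, |Ω a k| * |Ω b k|)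
          (fun a _ => by positivity) (Finset.mem_univ ia.2))
        exact Finset.single_le_sum (f := fun b => ∑ k, |Ω ia.2 k| * |Ω b k|)
          (fun b _ => by positivity) (Finset.mem_univ jc.2)

/-- The eigenvalues attached to the combination of quadratic forms with coefficients `t` are bounded
uniformly in the sample size, by a multiple of the `ℓ¹` norm of `t`. -/
lemma exists_abs_eigenvalues_le [IsProbabilityMeasure P] (hZ : IsLatentField P Z K)
    (Ω : Matrix (Fin p) (Fin p) ℝ) (s : (n : ℕ) → Fin n → EuclideanSpace ℝ (Fin d))
    {Δ : ℝ} (hΔ : 0 < Δ) (hs : ∀ n, ∀ i j : Fin n, i ≠ j → Δ ≤ ‖s n i - s n j‖)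
    {A α : ℝ} (hA : 0 < A) (hα : 0 < α) (hK : ∀ k, HasDecay A α (K k))
    {f : EuclideanSpace ℝ (Fin d) → ℝ} (hf : HasDecay A α f) :
    ∃ C : ℝ, 0 ≤ C ∧ ∀ n (t : Idx p → ℝ) i, |(isHermitian_conjSqrt (R P (obs Ω Z) (s n))
      (isSymm_combMatrix (s n) f f₀ t)).eigenvalues i| ≤ C * ∑ k, |t k| := by
  obtain ⟨C, hC0, hC⟩ := exists_sum_weight_le d (r := d + α) (by linarith) hΔ
  set D : ℝ := (∑ a, ∑ b, ∑ k, |Ω a k| * |Ω b k|) * A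
  refine ⟨p * (D * C) * (p * ((A + 1) * C)), by positivity, fun n t i => ?_⟩
  have hT : ∀ k ia, ∑ jc, |formMatrix (p := p) (s n) f f₀ k ia jc| ≤ p * ((A + 1) * C) := by
    intro k ia
    refine sum_abs_le_of_decay (by positivity) (hC (s n) (hs n)) (fun ia jc => ?_) ia
    rcases k with ⟨b, l⟩ | ⟨b, l⟩
    · refine (abs_T_le (s n) hf b l ia jc).trans ?_
      gcongr
      linarith
    · refine (abs_T_le (s n) (hasDecay_f₀ hα) b l ia jc).trans ?_
      gcongr
      linarith
  refine (abs_eigenvalues_conjSqrt_le (posSemidef_R hZ Ω (s n)) (isSymm_combMatrix (s n) f f₀ t)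
    (sum_abs_le_of_decay (by positivity) (hC (s n) (hs n)) (abs_R_le hZ Ω (s n) hA hK))
    (sum_abs_sum_smul_le hT t) (by positivity) i).trans (le_of_eq ?_)
  ring

end Observations

/-! ### Comparison with the normal law -/

section Comparison

open Matrix

variable {𝓤 : Type*} [MeasurableSpace 𝓤] {P : Measure 𝓤} [IsProbabilityMeasure P] {d p : ℕ}
  {Z : Fin p → EuclideanSpace ℝ (Fin d) → 𝓤 → ℝ} {K : Fin p → EuclideanSpace ℝ (Fin d) → ℝ}

lemma sum_sq_eigenvalues_le {n p : ℕ} {l : Fin n × Fin p → ℝ} {c : ℝ} (hl : ∀ i, |l i| ≤ c) :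
    (n : ℝ)⁻¹ * ∑ i, l i ^ 2 ≤ p * c ^ 2 := by
  have h : ∑ i, l i ^ 2 ≤ n * (p * c ^ 2) := by
    refine (Finset.sum_le_sum fun i _ => sq_le_sq' (abs_le.1 (hl i)).1 (abs_le.1 (hl i)).2).trans ?_
    simp [mul_assoc]
  rcases Nat.eq_zero_or_pos n with hn | hn
  · subst hn
    simp
    positivity
  · rw [inv_mul_le_iff₀ (by exact_mod_cast hn)]
    exact h

/-- The weights of the quadratic form of the `n`-th sample are `n^(-1/2) λ_i` with the `n p`
eigenvalues `λ_i` bounded by `c`: each weight tends to zero and their squares have bounded sum. -/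
lemma tendsto_charFun_sub (hZ : IsLatentField P Z K) (Ω : Matrix (Fin p) (Fin p) ℝ)
    (s : (n : ℕ) → Fin n → EuclideanSpace ℝ (Fin d)) (f g : EuclideanSpace ℝ (Fin d) → ℝ)
    (t : EuclideanSpace ℝ (Idx p)) {c : ℝ}
    (hc : ∀ n i, |(isHermitian_conjSqrt (R P (obs Ω Z) (s n))
      (isSymm_combMatrix (s n) f g t.ofLp)).eigenvalues i| ≤ c) :
    Tendsto (fun n => charFun (Q P hZ Ω (s n) f g : Measure (EuclideanSpace ℝ (Idx p))) t -
      charFun (normal (V P (obs Ω Z) (s n) f g) : Measure (EuclideanSpace ℝ (Idx p))) t)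
      atTop (𝓝 0) := by
  rw [Metric.tendsto_atTop]
  intro ε hε
  have hε' : 0 < ε / (p * c ^ 2 + 1) := by positivity
  obtain ⟨δ, hδ, h⟩ := exists_norm_prod_charFun_chiSq_sub_le hε'
  have hsmall : Tendsto (fun n : ℕ => √(n : ℝ) * (n : ℝ)⁻¹ * c) atTop (𝓝 0) := by
    have h1 : ∀ n : ℕ, √(n : ℝ) * (n : ℝ)⁻¹ = (√(n : ℝ))⁻¹ := fun n => by
      rw [← div_eq_mul_inv, Real.sqrt_div_self', one_div]
    simp only [h1]
    have h2 : Tendsto (fun n : ℕ => (√(n : ℝ))⁻¹) atTop (𝓝 0) :=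
      tendsto_inv_atTop_zero.comp (Real.tendsto_sqrt_atTop.comp tendsto_natCast_atTop_atTop)
    simpa using h2.mul_const c
  obtain ⟨N, hN⟩ := eventually_atTop.1 (hsmall.eventually (ge_mem_nhds hδ))
  refine ⟨N, fun n hn => ?_⟩
  set l := (isHermitian_conjSqrt (R P (obs Ω Z) (s n))
    (isSymm_combMatrix (s n) f g t.ofLp)).eigenvalues with hl
  have hsq : (√(n : ℝ) * (n : ℝ)⁻¹) ^ 2 = (n : ℝ)⁻¹ := by
    rw [mul_pow, Real.sq_sqrt n.cast_nonneg, pow_two, ← mul_assoc]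
    rcases eq_or_ne (n : ℝ) 0 with h0 | h0
    · simp [h0]
    · rw [mul_inv_cancel₀ h0, one_mul]
  have hb := h (√(n : ℝ) * (n : ℝ)⁻¹) l fun i => by
    rw [abs_mul, abs_of_nonneg (by positivity)]
    exact (mul_le_mul_of_nonneg_left (hc n i) (by positivity)).trans (hN n hn)
  rw [hsq] at hb
  rw [dist_zero_right, charFun_Q, charFun_normal (posSemidef_V hZ Ω (s n) f g), quadForm_V hZ,
    ← hl]
  have he : -((2 * (n : ℝ)⁻¹ * ∑ i, l i ^ 2 : ℝ) : ℂ) / 2 =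
      -(((n : ℝ)⁻¹ * ∑ i, l i ^ 2 : ℝ) : ℂ) := by
    push_cast
    ring
  rw [he]
  refine hb.trans_lt ?_
  calc ε / (p * c ^ 2 + 1) * ((n : ℝ)⁻¹ * ∑ i, l i ^ 2)
      ≤ ε / (p * c ^ 2 + 1) * (p * c ^ 2) := by
        exact mul_le_mul_of_nonneg_left (sum_sq_eigenvalues_le (hc n)) hε'.le
    _ < ε := by
        rw [div_mul_eq_mul_div, div_lt_iff₀ (by positivity)]
        nlinarith

lemma exists_quadForm_V_le (hZ : IsLatentField P Z K) (Ω : Matrix (Fin p) (Fin p) ℝ)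
    (s : (n : ℕ) → Fin n → EuclideanSpace ℝ (Fin d)) (f g : EuclideanSpace ℝ (Fin d) → ℝ) {c : ℝ}
    (hc : ∀ n (t : Idx p → ℝ) i, |(isHermitian_conjSqrt (R P (obs Ω Z) (s n))
      (isSymm_combMatrix (s n) f g t)).eigenvalues i| ≤ c * ∑ k, |t k|) :
    ∃ C : ℝ, ∀ n (t : Idx p → ℝ), t ⬝ᵥ V P (obs Ω Z) (s n) f g *ᵥ t ≤ C * (t ⬝ᵥ t) := by
  refine ⟨2 * (p * (c ^ 2 * Fintype.card (Idx p))), fun n t => ?_⟩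
  have h1 := sum_sq_eigenvalues_le (hc n t)
  have h2 : (∑ k, |t k|) ^ 2 ≤ Fintype.card (Idx p) * (t ⬝ᵥ t) := by
    refine (sq_sum_le_card_mul_sum_sq (s := Finset.univ) (f := fun k => |t k|)).trans (le_of_eq ?_)
    simp [dotProduct, pow_two]
  rw [quadForm_V hZ, mul_assoc]
  calc 2 * ((n : ℝ)⁻¹ * ∑ i, _) ≤ 2 * (p * (c * ∑ k, |t k|) ^ 2) := by gcongr
    _ = 2 * (p * (c ^ 2 * (∑ k, |t k|) ^ 2)) := by ring
    _ ≤ 2 * (p * (c ^ 2 * (Fintype.card (Idx p) * (t ⬝ᵥ t)))) := by gcongr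
    _ = _ := by ring

/-- The entries of a positive semidefinite matrix are bounded by any bound on its quadratic form on
unit vectors. -/
lemma abs_apply_le_of_posSemidef {ι : Type*} [Fintype ι] [DecidableEq ι] {S : Matrix ι ι ℝ}
    (hS : S.PosSemidef) {C : ℝ} (hC : ∀ t : ι → ℝ, t ⬝ᵥ S *ᵥ t ≤ C * (t ⬝ᵥ t)) (i j : ι) :
    |S i j| ≤ C := by
  have hsymm : S j i = S i j := by
    simpa using hS.isHermitian.apply i j
  have hdiag : ∀ k, S k k ≤ C := fun k => by simpa using hC (Pi.single k 1)
  have hp := hS.dotProduct_mulVec_nonneg (Pi.single i 1 + Pi.single j 1)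
  have hm := hS.dotProduct_mulVec_nonneg (Pi.single i 1 - Pi.single j 1)
  simp only [star_trivial, mulVec_add, mulVec_sub, add_dotProduct, sub_dotProduct, dotProduct_add,
    dotProduct_sub, mulVec_single_one, single_one_dotProduct, col_apply, hsymm] at hp hm
  rw [abs_le]
  constructor <;> linarith [hdiag i, hdiag j]

end Comparison

end SpatialBSS

end

theorem proposition3 {𝓤 : Type*} [MeasurableSpace 𝓤] (P : Measure 𝓤) [IsProbabilityMeasure P]
    (d p : ℕ)
    (Z : Fin p → EuclideanSpace ℝ (Fin d) → 𝓤 → ℝ)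
    (K : Fin p → EuclideanSpace ℝ (Fin d) → ℝ)
    (hZ : SpatialBSS.IsLatentField P Z K)
    (Ω : Matrix (Fin p) (Fin p) ℝ) (hΩ : IsUnit Ω.det)
    (s : (n : ℕ) → Fin n → EuclideanSpace ℝ (Fin d))
    (Δ : ℝ) (hΔ : 0 < Δ) (hs : ∀ n, ∀ i j : Fin n, i ≠ j → Δ ≤ ‖s n i - s n j‖)
    (A α : ℝ) (hA : 0 < A) (hα : 0 < α)
    (hK : ∀ k, SpatialBSS.HasDecay A α (K k))
    (f : EuclideanSpace ℝ (Fin d) → ℝ) (hf : SpatialBSS.HasDecay A α f) :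
    (∀ n, (SpatialBSS.V P (SpatialBSS.obs Ω Z) (s n) f SpatialBSS.f₀).PosSemidef) ∧
    (∀ m : MetricSpace (ProbabilityMeasure (EuclideanSpace ℝ (SpatialBSS.Idx p))),
      SpatialBSS.GeneratesWeakTopology m →
      Tendsto (fun n => m.dist (SpatialBSS.Q P hZ Ω (s n) f SpatialBSS.f₀)
        (SpatialBSS.normal (SpatialBSS.V P (SpatialBSS.obs Ω Z) (s n) f SpatialBSS.f₀)))
        atTop (𝓝 0)) ∧
    (∃ C : ℝ, ∀ n, ∀ μ : ℝ,
      Module.End.HasEigenvalue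
        (Matrix.toLin' (SpatialBSS.V P (SpatialBSS.obs Ω Z) (s n) f SpatialBSS.f₀)) μ →
      μ ≤ C) := by
  obtain ⟨c, -, hc⟩ := SpatialBSS.exists_abs_eigenvalues_le hZ Ω s hΔ hs hA hα hK hf
  obtain ⟨C, hC⟩ := SpatialBSS.exists_quadForm_V_le hZ Ω s f SpatialBSS.f₀ hc
  have hV := fun n => SpatialBSS.posSemidef_V hZ Ω (s n) f SpatialBSS.f₀
  refine ⟨hV, fun m hm => ?_, C, fun n μ hμ => ?_⟩
  · exact SpatialBSS.tendsto_dist_normal hV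
      (fun n => SpatialBSS.abs_apply_le_of_posSemidef (hV n) (hC n))
      (fun t => SpatialBSS.tendsto_charFun_sub hZ Ω s f SpatialBSS.f₀ t fun n => hc n t.ofLp) m hm
  · obtain ⟨v, hv, hv0⟩ := hμ.exists_hasEigenvector
    have h1 := hC n v
    rw [← Matrix.toLin'_apply, Module.End.mem_eigenspace_iff.1 hv, dotProduct_smul,
      smul_eq_mul] at h1
    have h2 : 0 < dotProduct v v := by
      have := Matrix.dotProduct_star_self_pos_iff.2 hv0
      rwa [star_trivial] at this
    exact le_of_mul_le_mul_right h1 h2
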